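/- **Setting.** Let $X=[\mathbf x_1,\dots,\mathbf x_n]\in\mathbb R^{d\times n}$ and let $\mathrm{St}(d,K)=\{U\in\mathbb R^{d\times K}: U^\top U=I\}$. For $C\in\mathbb R^{d\times K}$, a *$U$-factor* of $C$ is a $U\in\mathrm{St}(d,K)$ such that $C=UH$ for some symmetric positive semidefinite $H\in\mathbb R^{K\times K}$; write $U\in\operatorname{PD}(C)$. Let $\|V\|_1=\sum_{i,j}|V_{ij}|$, let $\partial\|V\|_1$ be its convex subdifferential at $V$, and let $\operatorname{sgn}$ (with $\operatorname{sgn}(0)=0$) act entrywise. For the problem $\max\{\|X^\top U\|_1: U\in\mathrm{St}(d,K)\}$, a point $U\in\mathrm{St}(d,K)$ is a *KKT point* if $W=U\Lambda$ for some symmetric $\Lambda\in\mathbb R^{K\times K}$ and some $W\in X\,\partial\|V\|_1\big|_{V=X^\top U}$, and a *FOC point* if $U\in\operatorname{PD}(W)$ for some $W\in X\,\partial\|V\|_1\big|_{V=X^\top U}$. Given $\tau>0$, $\beta>0$, $\gamma\in[0,1)$, a sequence $(U^k,S^k,E^k)_{k\ge0}$ is *generated by PAMe* if $U^0\in\mathrm{St}(d,K)$,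 $S^0\in\{0,\pm1\}^{n\times K}$, $E^0\in\mathbb R^{d\times K}$ and, for all $k\ge 0$, $$S^{k+1}=\operatorname{sgn}(\tau S^k+X^\top E^k),\qquad U^{k+1}\in\operatorname{PD}(\beta U^k+XS^{k+1}),\qquad E^{k+1}=U^{k+1}-\gamma(U^k-U^{k+1}).$$ **Theorem.** There are $\tau_0>0$ and $\beta_0>0$, depending only on $X$ and $K$, such that for all $\tau>0$ and $\beta>0$ there is $\gamma_0>0$, depending only on $X,K,\tau,\beta$, with the following property. Let $\gamma\in[0,1)$, $\gamma<\gamma_0$, and let $(U^k,S^k,E^k)$ be generated by PAMe with parameters $\tau,\beta,\gamma$. Then: 1. After finitely many steps $S^k$ does not change: there is a first index $k'$ with $S^{k'}=S^{k'+1}=\cdots=:S^*$. 2. If $\tau<\tau_0$, then there is $U^*\in\mathrm{St}(d,K)$ with $U^*\in\operatorname{PD}(\beta U^*+XS^*)$ (so that $XS^*=U^*\Lambda$ with $\Lambda$ symmetric) and $S^*\in\partial\|V\|_1\big|_{V=X^\top U^*}$; in particular $U^*$ is a KKT point. 3. If furthermore $\beta<\beta_0$, then the $U^*$ of item 2 is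 a $U$-factor of $XS^*$ and is a FOC point. 4. If $\tau<\tau_0$, $\beta<\beta_0$ and $\operatorname{rank}(XS^*)=K$, then PAMe can be stopped at step $k'$ with output $\operatorname{PD}(XS^{k'})=\operatorname{PD}(XS^*)$: the $U$-factor of $XS^{k'}$ is unique, and it is a FOC point. -/

import Mathlib

namespace L1PCA

/-- Entrywise (Frobenius) inner product of two real matrices. -/
def frobInner {m k : ℕ} (A B : Matrix (Fin m) (Fin k) ℝ) : ℝ :=
  ∑ i, ∑ j, A i j * B i j

/-- Entrywise `L₁`-norm of a real matrix. -/
def oneNorm {m k : ℕ} (V : Matrix (Fin m) (Fin k) ℝ) : ℝ :=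
  ∑ i, ∑ j, |V i j|

/-- The convex subdifferential of the entrywise `L₁`-norm at `V`. -/
def subdiffOneNorm {m k : ℕ} (V : Matrix (Fin m) (Fin k) ℝ) :
    Set (Matrix (Fin m) (Fin k) ℝ) :=
  {G | ∀ Y, oneNorm V + frobInner G (Y - V) ≤ oneNorm Y}

/-- The Stiefel manifold `St(m, k)`. -/
def stiefel (m k : ℕ) : Set (Matrix (Fin m) (Fin k) ℝ) :=
  {U | U.transpose * U = 1}

/-- `U` is a `U`-factor of a polar decomposition `C = U H` (with `Uᵀ U = I` and `H` symmetric
positive semidefinite); this is the set-valued relation `U ∈ PD(C)`. -/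
def IsUFactor {m k : ℕ} (C U : Matrix (Fin m) (Fin k) ℝ) : Prop :=
  U ∈ stiefel m k ∧ ∃ H : Matrix (Fin k) (Fin k) ℝ, H.PosSemidef ∧ C = U * H

/-- KKT point of `max ‖Xᵀ U‖₁` subject to `U ∈ St(d, K)`. -/
def IsKKT {d n K : ℕ} (X : Matrix (Fin d) (Fin n) ℝ) (U : Matrix (Fin d) (Fin K) ℝ) : Prop :=
  U ∈ stiefel d K ∧ ∃ Λ : Matrix (Fin K) (Fin K) ℝ, Λ.IsSymm ∧
    ∃ G ∈ subdiffOneNorm (X.transpose * U), X * G = U * Λ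

/-- FOC point of the same problem: `U ∈ PD(W)` for some `W ∈ X ∂‖V‖₁` at `V = Xᵀ U`. -/
def IsFOC {d n K : ℕ} (X : Matrix (Fin d) (Fin n) ℝ) (U : Matrix (Fin d) (Fin K) ℝ) : Prop :=
  ∃ G ∈ subdiffOneNorm (X.transpose * U), IsUFactor (X * G) U

/-- `(U k, S k, E k)` is a sequence generated by PAMe. The initial `U`-iterate lies on the
Stiefel manifold, the initial sign variable has entries in `{-1, 0, 1}`, and `E 0` is arbitrary.
Any `U`-factor may be selected in the `U`-step. -/
structure IsPAMe {d n K : ℕ} (X : Matrix (Fin d) (Fin n) ℝ) (τ β γ : ℝ)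
    (U : ℕ → Matrix (Fin d) (Fin K) ℝ) (S : ℕ → Matrix (Fin n) (Fin K) ℝ)
    (E : ℕ → Matrix (Fin d) (Fin K) ℝ) : Prop where
  init_U : U 0 ∈ stiefel d K
  init_S : ∀ i j, S 0 i j = -1 ∨ S 0 i j = 0 ∨ S 0 i j = 1
  step_S : ∀ k, S (k + 1) = (τ • S k + X.transpose * E k).map Real.sign
  step_U : ∀ k, IsUFactor (β • U k + X * S (k + 1)) (U (k + 1))
  step_E : ∀ k, E (k + 1) = U (k + 1) - γ • (U k - U (k + 1))

end L1PCA

/-!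
With `S` frozen, the `U`-step is a fixed point iteration for `U ∈ PD(β U + X S)`, and the argument
has two halves.

*The signs freeze.* Both steps are proximal ascent steps on `⟨S, Xᵀ U⟩ + τ / 2 ‖S‖²`. As long as
`4 γ² ‖X‖² ≤ τ β`, the extrapolation error `γ ⟨S' - S, Xᵀ (U - V)⟩` is absorbed by half of the two
proximal gains, so the objective minus `β / 4 ‖U - V‖²` is a bounded Lyapunov function. Consecutive
differences of `S` and `U` therefore tend to zero, and `S`, which takes finitely many values, is
eventually constant. A cluster point `U` of the `U`-iterates is a fixed point, and `S` misses being
a subgradient at `Xᵀ U` by at most `2 τ n K`.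

*Finitely many fixed point sets.* `U` is a fixed point iff `X S = U Λ` with `Λ = Uᵀ X S` symmetric
and `β + Λ ≥ 0`. Since `Λ² = (X S)ᵀ (X S)`, the eigenvalues of `Λ` are singular values of `X S` up
to sign, so the set of fixed points changes only when `β` passes a singular value. Hence it equals
the set of `U`-factors of `X S` for small `β`, and altogether finitely many compact sets occur for
all `S` and `β`. On each of them the subgradient gap either vanishes somewhere or is bounded below,
which yields a threshold for `τ` independent of `β`.
-/

namespace L1PCA

open Matrix Filter Topology

/-! ### Limits and compactness -/

lemma tendsto_zero_of_le_sub_of_bddAbove {a Φ : ℕ → ℝ} (ha : ∀ k, 0 ≤ a k)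
    (hΦ : ∀ k, a k ≤ Φ (k + 1) - Φ k) (hbdd : BddAbove (Set.range Φ)) :
    Tendsto a atTop (𝓝 0) := by
  have hmono : Monotone Φ := monotone_nat_of_le_succ fun k => by linarith [ha k, hΦ k]
  have hlim := tendsto_atTop_ciSup hmono hbdd
  have hdiff := (hlim.comp (tendsto_add_atTop_nat 1)).sub hlim
  rw [sub_self] at hdiff
  exact squeeze_zero ha hΦ hdiff

lemma eventually_exists_le_of_isCompact {α β : Type*} [TopologicalSpace α] [LinearOrder β]
    [TopologicalSpace β] [OrderTopology β] {s : Set α} (hs : IsCompact s) {g : α → β}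
    (hg : LowerSemicontinuousOn g s) (c : β) :
    ∀ᶠ ε in 𝓝 c, ∀ x ∈ s, g x ≤ ε → ∃ y ∈ s, g y ≤ c := by
  rcases s.eq_empty_or_nonempty with rfl | hne
  · exact Eventually.of_forall fun _ _ hx => hx.elim
  obtain ⟨y, hy, hmin⟩ := hg.exists_isMinOn hne hs
  rcases le_or_gt (g y) c with hyc | hcy
  · exact Eventually.of_forall fun _ _ _ _ => ⟨y, hy, hyc⟩
  · filter_upwards [gt_mem_nhds hcy] with ε hε x hx hxε
    exact absurd (hmin hx) (not_le.2 (hxε.trans_lt hε))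

/-! ### Matrices -/

lemma isUnit_of_rank_eq_card {ι F : Type*} [Fintype ι] [DecidableEq ι] [Field F]
    {A : Matrix ι ι F} (hA : A.rank = Fintype.card ι) : IsUnit A := by
  have hrange : LinearMap.range A.mulVecLin = ⊤ :=
    Submodule.eq_top_of_finrank_eq (hA.trans (Module.finrank_fintype_fun_eq_card F).symm)
  exact mulVec_surjective_iff_isUnit.1 (LinearMap.range_eq_top.1 hrange)

open scoped ComplexOrder in
lemma isClosed_setOf_posSemidef {ι 𝕜 : Type*} [Finite ι] [RCLike 𝕜] :
    IsClosed {H : Matrix ι ι 𝕜 | H.PosSemidef} := by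
  have := Fintype.ofFinite ι
  simp only [posSemidef_iff_dotProduct_mulVec, Set.ofPred_and, Set.ofPred_forall, IsHermitian]
  refine (isClosed_eq (by fun_prop) continuous_id).inter (isClosed_iInter fun x => ?_)
  exact isClosed_le continuous_const (by fun_prop)

lemma posSemidef_smul_one_add_iff {ι : Type*} [Fintype ι] [DecidableEq ι] {A : Matrix ι ι ℝ}
    {b : ℝ} : (b • 1 + A).PosSemidef ↔ A.IsHermitian ∧ ∀ a ∈ spectrum ℝ A, 0 ≤ b + a := by
  have hb : (b • (1 : Matrix ι ι ℝ)).IsHermitian := isHermitian_one.smul (IsSelfAdjoint.all b)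
  have hherm : (b • 1 + A).IsHermitian ↔ A.IsHermitian :=
    ⟨fun h => by simpa using h.sub hb, hb.add⟩
  rw [posSemidef_iff_isHermitian_and_spectrum_nonneg, hherm, ← Algebra.algebraMap_eq_smul_one,
    ← spectrum.singleton_add_eq, Set.singleton_add, Set.image_subset_iff]
  rfl

/-! ### The Frobenius inner product -/

section Frobenius

variable {m k : ℕ} {A A' B C : Matrix (Fin m) (Fin k) ℝ}

lemma frobInner_eq_trace (A B : Matrix (Fin m) (Fin k) ℝ) : frobInner A B = (Aᵀ * B).trace := by
  simp only [frobInner, trace, diag, mul_apply, transpose_apply]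
  exact Finset.sum_comm

lemma frobInner_comm (A B : Matrix (Fin m) (Fin k) ℝ) : frobInner A B = frobInner B A := by
  simp only [frobInner, mul_comm]

lemma frobInner_add_right (A B C : Matrix (Fin m) (Fin k) ℝ) :
    frobInner A (B + C) = frobInner A B + frobInner A C := by
  simp only [frobInner_eq_trace, Matrix.mul_add, trace_add]

lemma frobInner_smul_right (c : ℝ) (A B : Matrix (Fin m) (Fin k) ℝ) :
    frobInner A (c • B) = c * frobInner A B := by
  simp only [frobInner_eq_trace, Matrix.mul_smul, trace_smul, smul_eq_mul]

lemma frobInner_sub_right (A B C : Matrix (Fin m) (Fin k) ℝ) :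
    frobInner A (B - C) = frobInner A B - frobInner A C := by
  simp only [frobInner_eq_trace, Matrix.mul_sub, trace_sub]

lemma frobInner_sub_left (A B C : Matrix (Fin m) (Fin k) ℝ) :
    frobInner (A - B) C = frobInner A C - frobInner B C := by
  simp only [frobInner_comm _ C, frobInner_sub_right]

lemma frobInner_sub_self (A B : Matrix (Fin m) (Fin k) ℝ) :
    frobInner (A - B) (A - B) = frobInner A A - 2 * frobInner A B + frobInner B B := by
  rw [frobInner_sub_left, frobInner_sub_right, frobInner_sub_right, frobInner_comm B A]
  ring

lemma frobInner_transpose_mul_right {d n : ℕ} (X : Matrix (Fin d) (Fin n) ℝ)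
    (S : Matrix (Fin n) (Fin k) ℝ) (U : Matrix (Fin d) (Fin k) ℝ) :
    frobInner S (Xᵀ * U) = frobInner (X * S) U := by
  simp only [frobInner_eq_trace, transpose_mul, Matrix.mul_assoc]

lemma frobInner_self_nonneg (A : Matrix (Fin m) (Fin k) ℝ) : 0 ≤ frobInner A A :=
  Finset.sum_nonneg fun _ _ => Finset.sum_nonneg fun _ _ => mul_self_nonneg _

lemma sq_apply_le_frobInner_self (A : Matrix (Fin m) (Fin k) ℝ) (i : Fin m) (j : Fin k) :
    A i j ^ 2 ≤ frobInner A A := by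
  calc A i j ^ 2 = A i j * A i j := sq _
    _ ≤ ∑ j, A i j * A i j :=
      Finset.single_le_sum (f := fun j => A i j * A i j) (fun _ _ => mul_self_nonneg _)
        (Finset.mem_univ j)
    _ ≤ frobInner A A :=
      Finset.single_le_sum (f := fun i => ∑ j, A i j * A i j)
        (fun _ _ => Finset.sum_nonneg fun _ _ => mul_self_nonneg _) (Finset.mem_univ i)

lemma sq_frobInner_le (A B : Matrix (Fin m) (Fin k) ℝ) :
    frobInner A B ^ 2 ≤ frobInner A A * frobInner B B := by
  simp only [frobInner, ← Fintype.sum_prod_type', ← sq]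
  exact Finset.sum_mul_sq_le_sq_mul_sq _ _ _

lemma frobInner_mul_self_le {d n : ℕ} (X : Matrix (Fin d) (Fin n) ℝ)
    (A : Matrix (Fin n) (Fin k) ℝ) :
    frobInner (X * A) (X * A) ≤ frobInner X X * frobInner A A := by
  have hA : frobInner A A = ∑ j, ∑ l, A l j ^ 2 := by
    simp only [frobInner, sq]
    exact Finset.sum_comm
  rw [hA, frobInner, frobInner, Finset.sum_mul_sum]
  refine Finset.sum_le_sum fun i _ => Finset.sum_le_sum fun j _ => ?_
  simp only [mul_apply, ← sq]
  exact Finset.sum_mul_sq_le_sq_mul_sq _ _ _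

lemma mul_frobInner_transpose_mul_le {d n : ℕ} {X : Matrix (Fin d) (Fin n) ℝ} {τ β γ : ℝ}
    (hτ : 0 ≤ τ) (hβ : 0 ≤ β) (hγ : 4 * γ ^ 2 * frobInner X X ≤ τ * β)
    (A : Matrix (Fin n) (Fin k) ℝ) (B : Matrix (Fin d) (Fin k) ℝ) :
    γ * frobInner A (Xᵀ * B) ≤ τ / 4 * frobInner A A + β / 4 * frobInner B B := by
  have hA := frobInner_self_nonneg A
  have hB := frobInner_self_nonneg B
  refine le_of_sq_le_sq ?_ (by positivity)
  calc (γ * frobInner A (Xᵀ * B)) ^ 2 = γ ^ 2 * frobInner (X * A) B ^ 2 := by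
        rw [frobInner_transpose_mul_right, mul_pow]
    _ ≤ γ ^ 2 * (frobInner X X * frobInner A A * frobInner B B) := by
        refine mul_le_mul_of_nonneg_left ((sq_frobInner_le _ _).trans ?_) (sq_nonneg γ)
        exact mul_le_mul_of_nonneg_right (frobInner_mul_self_le X A) hB
    _ = 4 * γ ^ 2 * frobInner X X * (frobInner A A * frobInner B B) / 4 := by ring
    _ ≤ τ * β * (frobInner A A * frobInner B B) / 4 := by gcongr
    _ ≤ (τ / 4 * frobInner A A + β / 4 * frobInner B B) ^ 2 := by
        linarith [sq_nonneg (τ / 4 * frobInner A A - β / 4 * frobInner B B)]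

lemma proximal_gain {b : ℝ} (h : frobInner A (b • A + C) ≤ frobInner A' (b • A + C)) :
    b / 2 * frobInner (A' - A) (A' - A) ≤
      frobInner A' C - frobInner A C + b / 2 * (frobInner A' A' - frobInner A A) := by
  simp only [frobInner_add_right, frobInner_smul_right] at h
  rw [frobInner_sub_self]
  linarith

lemma tendsto_zero_of_tendsto_frobInner_self {ι : Type*} {l : Filter ι}
    {A : ι → Matrix (Fin m) (Fin k) ℝ} (h : Tendsto (fun t => frobInner (A t) (A t)) l (𝓝 0)) :
    Tendsto A l (𝓝 0) := by
  refine tendsto_pi_nhds.2 fun i => tendsto_pi_nhds.2 fun j => ?_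
  have hsq : Tendsto (fun t => A t i j ^ 2) l (𝓝 0) :=
    squeeze_zero (fun _ => sq_nonneg _) (fun t => sq_apply_le_frobInner_self (A t) i j) h
  have habs := (Real.continuous_sqrt.tendsto 0).comp hsq
  rw [Real.sqrt_zero] at habs
  exact (tendsto_zero_iff_abs_tendsto_zero _).2 (habs.congr fun t => Real.sqrt_sq_eq_abs _)

end Frobenius

/-! ### Polar factors -/

section Polar

variable {m k : ℕ} {C U V : Matrix (Fin m) (Fin k) ℝ} {b β : ℝ}

lemma transpose_mul_self_of_mem_stiefel (hU : U ∈ stiefel m k) : Uᵀ * U = 1 := hU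

lemma frobInner_self_of_mem_stiefel (hU : U ∈ stiefel m k) : frobInner U U = k := by
  rw [frobInner_eq_trace, transpose_mul_self_of_mem_stiefel hU, trace_one, Fintype.card_fin]

lemma isClosed_stiefel (m k : ℕ) : IsClosed (stiefel m k) :=
  isClosed_eq (by fun_prop) continuous_const

lemma isCompact_stiefel (m k : ℕ) : IsCompact (stiefel m k) := by
  have hbox : IsCompact (Set.univ.pi fun _ : Fin m => Set.univ.pi fun _ : Fin k =>
      Set.Icc (-√(k : ℝ)) √k) :=
    isCompact_univ_pi fun _ => isCompact_univ_pi fun _ => isCompact_Icc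
  refine hbox.of_isClosed_subset (isClosed_stiefel m k) fun U hU i _ j _ => ?_
  have hij := sq_apply_le_frobInner_self U i j
  rw [frobInner_self_of_mem_stiefel hU] at hij
  exact abs_le.1 (Real.abs_le_sqrt hij)

lemma isUFactor_iff :
    IsUFactor C U ↔ U ∈ stiefel m k ∧ (Uᵀ * C).PosSemidef ∧ C = U * (Uᵀ * C) := by
  refine ⟨?_, fun h => ⟨h.1, _, h.2⟩⟩
  rintro ⟨hU, H, hH, rfl⟩
  have hfactor : Uᵀ * (U * H) = H := by
    rw [← Matrix.mul_assoc, transpose_mul_self_of_mem_stiefel hU, Matrix.one_mul]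
  rw [hfactor]
  exact ⟨hU, hH, rfl⟩

lemma isClosed_setOf_isUFactor (m k : ℕ) :
    IsClosed {p : Matrix (Fin m) (Fin k) ℝ × Matrix (Fin m) (Fin k) ℝ | IsUFactor p.1 p.2} := by
  simp only [isUFactor_iff, Set.ofPred_and]
  refine ((isClosed_stiefel m k).preimage continuous_snd).inter
    ((isClosed_setOf_posSemidef.preimage ?_).inter (isClosed_eq ?_ ?_)) <;> fun_prop

lemma trace_sub_mul_mul_sub (hU : U ∈ stiefel m k) (hV : V ∈ stiefel m k)
    {H : Matrix (Fin k) (Fin k) ℝ} (hH : H.IsSymm) :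
    ((U - V) * H * (U - V)ᵀ).trace = 2 * (frobInner U (U * H) - frobInner V (U * H)) := by
  have hcyc (A B : Matrix (Fin m) (Fin k) ℝ) : (A * H * Bᵀ).trace = (Bᵀ * A * H).trace := by
    rw [trace_mul_comm, Matrix.mul_assoc]
  have hswap : (Uᵀ * V * H).trace = (Vᵀ * U * H).trace := by
    rw [← trace_transpose (Uᵀ * V * H), transpose_mul, transpose_mul, transpose_transpose, hH.eq,
      trace_mul_comm]
  simp only [transpose_sub, Matrix.sub_mul, Matrix.mul_sub, trace_sub, hcyc, frobInner_eq_trace,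
    transpose_mul_self_of_mem_stiefel hU, transpose_mul_self_of_mem_stiefel hV, hswap,
    ← Matrix.mul_assoc]
  ring

lemma IsUFactor.frobInner_le (hU : IsUFactor C U) (hV : V ∈ stiefel m k) :
    frobInner V C ≤ frobInner U C := by
  obtain ⟨hUs, H, hH, rfl⟩ := hU
  have htrace : 0 ≤ ((U - V) * H * (U - V)ᵀ).trace :=
    (hH.mul_mul_conjTranspose_same (U - V)).trace_nonneg
  have hsymm : H.IsSymm := hH.isHermitian
  rw [trace_sub_mul_mul_sub hUs hV hsymm] at htrace
  linarith

lemma transpose_mul_sq (hsymm : (Uᵀ * C).IsHermitian) (hC : C = U * (Uᵀ * C)) :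
    (Uᵀ * C) ^ 2 = Cᵀ * C := by
  calc (Uᵀ * C) ^ 2 = (Uᵀ * C)ᵀ * (Uᵀ * C) := by rw [show (Uᵀ * C)ᵀ = Uᵀ * C from hsymm, sq]
    _ = Cᵀ * (U * (Uᵀ * C)) := by
      rw [transpose_mul, transpose_transpose, Matrix.mul_assoc]
    _ = Cᵀ * C := by rw [← hC]

open scoped MatrixOrder in
lemma IsUFactor.transpose_mul_eq (hU : IsUFactor C U) (hV : IsUFactor C V) :
    Uᵀ * C = Vᵀ * C := by
  rw [isUFactor_iff] at hU hV
  rw [← CFC.sq_eq_sq_iff _ _ hU.2.1.nonneg hV.2.1.nonneg,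
    transpose_mul_sq hU.2.1.isHermitian hU.2.2, transpose_mul_sq hV.2.1.isHermitian hV.2.2]

lemma IsUFactor.eq_of_rank_eq (hU : IsUFactor C U) (hV : IsUFactor C V) (hC : C.rank = k) :
    U = V := by
  have hUC : C = U * (Uᵀ * C) := (isUFactor_iff.1 hU).2.2
  have hVC : C = V * (Uᵀ * C) := by
    rw [hU.transpose_mul_eq hV]
    exact (isUFactor_iff.1 hV).2.2
  have hrank : (Uᵀ * C).rank = Fintype.card (Fin k) := by
    have hle := rank_mul_le_right U (Uᵀ * C)
    rw [← hUC, hC] at hle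
    exact (rank_le_card_width _).antisymm (by rwa [Fintype.card_fin])
  have := (isUnit_of_rank_eq_card hrank).invertible
  exact mul_left_injective_of_invertible (Uᵀ * C) (hUC.symm.trans hVC)

/-! ### Fixed points of the `U`-step -/

/-- The points left unchanged by the `U`-step with parameter `β` when `C = X S` is kept fixed,
that is the solutions of `U ∈ PD(β U + C)`. -/
def polarFixedPoints (C : Matrix (Fin m) (Fin k) ℝ) (β : ℝ) : Set (Matrix (Fin m) (Fin k) ℝ) :=
  {U | IsUFactor (β • U + C) U}

/-- The set of singular values of `C`, encoded as the square roots of the eigenvalues of `Cᵀ C`;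
these are the only parameters `β` at which `polarFixedPoints C β` can change. -/
def singularValues (C : Matrix (Fin m) (Fin k) ℝ) : Set ℝ :=
  Real.sqrt '' spectrum ℝ (Cᵀ * C)

lemma finite_singularValues (C : Matrix (Fin m) (Fin k) ℝ) : (singularValues C).Finite :=
  (finite_spectrum (Cᵀ * C)).image _

lemma mem_polarFixedPoints_zero : U ∈ polarFixedPoints C 0 ↔ IsUFactor C U := by
  simp [polarFixedPoints]

lemma mem_polarFixedPoints_iff :
    U ∈ polarFixedPoints C β ↔ U ∈ stiefel m k ∧ C = U * (Uᵀ * C) ∧ (Uᵀ * C).IsHermitian ∧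
      ∀ a ∈ spectrum ℝ (Uᵀ * C), 0 ≤ β + a := by
  rw [polarFixedPoints, Set.mem_ofPred_eq, isUFactor_iff]
  refine and_congr_right fun hU => ?_
  rw [Matrix.mul_add, Matrix.mul_smul, transpose_mul_self_of_mem_stiefel hU,
    posSemidef_smul_one_add_iff, Matrix.mul_add, Matrix.mul_smul, Matrix.mul_one, add_right_inj,
    and_comm]

lemma isCompact_polarFixedPoints (C : Matrix (Fin m) (Fin k) ℝ) (β : ℝ) :
    IsCompact (polarFixedPoints C β) := by
  refine (isCompact_stiefel m k).of_isClosed_subset ?_ fun U hU => hU.1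
  exact (isClosed_setOf_isUFactor m k).preimage
    (f := fun U : Matrix (Fin m) (Fin k) ℝ => (β • U + C, U)) (by fun_prop)

lemma polarFixedPoints_eq_of_disjoint (hb : 0 ≤ b) (hbβ : b ≤ β)
    (hdisj : Disjoint (singularValues C) (Set.Ioc b β)) :
    polarFixedPoints C β = polarFixedPoints C b := by
  ext U
  rw [mem_polarFixedPoints_iff, mem_polarFixedPoints_iff]
  refine and_congr_right fun _ => and_congr_right fun hC => and_congr_right fun hsymm =>
    ⟨fun hβ a ha => ?_, fun hb a ha => by linarith [hb a ha]⟩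
  by_contra! hneg
  have hsingular : -a ∈ singularValues C := by
    refine ⟨a ^ 2, transpose_mul_sq hsymm hC ▸ spectrum.pow_mem_pow _ 2 ha, ?_⟩
    rw [Real.sqrt_sq_eq_abs, abs_of_neg (by linarith)]
  exact Set.disjoint_left.1 hdisj hsingular ⟨by linarith, by linarith [hβ a ha]⟩

lemma finite_image_polarFixedPoints (C : Matrix (Fin m) (Fin k) ℝ) :
    (polarFixedPoints C '' Set.Ici 0).Finite := by
  refine (((finite_singularValues C).insert 0).image (polarFixedPoints C)).subset ?_
  rintro _ ⟨β, hβ, rfl⟩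
  obtain ⟨b, ⟨hbC, hbβ⟩, hmax⟩ :=
    Set.exists_max_image (insert 0 (singularValues C) ∩ Set.Iic β) id
      (((finite_singularValues C).insert 0).inter_of_left _) ⟨0, Set.mem_insert _ _, hβ⟩
  have hb : 0 ≤ b := hmax 0 ⟨Set.mem_insert _ _, hβ⟩
  refine ⟨b, hbC, (polarFixedPoints_eq_of_disjoint hb hbβ ?_).symm⟩
  exact Set.disjoint_left.2 fun s hs hsb =>
    hsb.1.not_ge (hmax s ⟨Set.mem_insert_of_mem _ hs, hsb.2⟩)

lemma eventually_polarFixedPoints_eq (C : Matrix (Fin m) (Fin k) ℝ) :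
    ∀ᶠ β in 𝓝[>] (0 : ℝ), polarFixedPoints C β = polarFixedPoints C 0 := by
  have hlt : ∀ᶠ β in 𝓝[>] (0 : ℝ), ∀ s ∈ singularValues C, 0 < s → β < s := by
    refine (eventually_all_finite (finite_singularValues C)).2 fun s _ => ?_
    exact eventually_imp_distrib_left.2 fun hs => nhdsWithin_le_nhds (gt_mem_nhds hs)
  filter_upwards [hlt, self_mem_nhdsWithin] with β hβ hpos
  refine polarFixedPoints_eq_of_disjoint le_rfl (le_of_lt hpos) ?_
  exact Set.disjoint_left.2 fun s hs hsβ => (hβ s hs hsβ.1).not_ge hsβ.2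

end Polar

/-! ### Sign matrices and subgradients -/

section Sign

variable {m k : ℕ} {S V : Matrix (Fin m) (Fin k) ℝ}

/-- The matrices with entries in `{-1, 0, 1}`, the range of the sign variable of PAMe. -/
def signMatrices (m k : ℕ) : Set (Matrix (Fin m) (Fin k) ℝ) :=
  {S | ∀ i j, S i j = -1 ∨ S i j = 0 ∨ S i j = 1}

/-- The Fenchel–Young gap of the entrywise `L₁`-norm: for `S` with entries in `[-1, 1]` it is
nonnegative, and it vanishes iff `S` is a subgradient at `V`. -/
def subgradGap (S V : Matrix (Fin m) (Fin k) ℝ) : ℝ :=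
  oneNorm V - frobInner S V

lemma finite_signMatrices (m k : ℕ) : (signMatrices m k).Finite := by
  have hpi : (Set.univ.pi fun _ : Fin m =>
      Set.univ.pi fun _ : Fin k => ({-1, 0, 1} : Set ℝ)).Finite :=
    Set.Finite.pi fun _ => Set.Finite.pi fun _ => Set.toFinite _
  refine hpi.subset fun S hS i _ j _ => ?_
  simpa using hS i j

lemma abs_apply_le_one_of_mem_signMatrices (hS : S ∈ signMatrices m k) (i : Fin m) (j : Fin k) :
    |S i j| ≤ 1 := by
  rcases hS i j with h | h | h <;> simp [h]

lemma map_sign_mem_signMatrices (V : Matrix (Fin m) (Fin k) ℝ) :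
    V.map Real.sign ∈ signMatrices m k :=
  fun i j => Real.sign_apply_eq (V i j)

lemma eq_of_mem_signMatrices_of_frobInner_lt_one (hS : S ∈ signMatrices m k)
    (hV : V ∈ signMatrices m k) (h : frobInner (S - V) (S - V) < 1) : S = V := by
  ext i j
  have hij := (sq_apply_le_frobInner_self (S - V) i j).trans_lt h
  rw [Matrix.sub_apply] at hij
  rcases hS i j with hs | hs | hs <;> rcases hV i j with hv | hv | hv <;>
    rw [hs, hv] at hij ⊢ <;> norm_num at hij

lemma frobInner_le_oneNorm (hS : ∀ i j, |S i j| ≤ 1) (V : Matrix (Fin m) (Fin k) ℝ) :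
    frobInner S V ≤ oneNorm V := by
  refine Finset.sum_le_sum fun i _ => Finset.sum_le_sum fun j _ => ?_
  calc S i j * V i j ≤ |S i j| * |V i j| := (le_abs_self _).trans (abs_mul _ _).le
    _ ≤ |V i j| := mul_le_of_le_one_left (abs_nonneg _) (hS i j)

lemma sign_mul_self_eq_abs (x : ℝ) : Real.sign x * x = |x| := by
  rcases lt_trichotomy x 0 with hx | rfl | hx
  · rw [Real.sign_of_neg hx, abs_of_neg hx, neg_one_mul]
  · simp
  · rw [Real.sign_of_pos hx, abs_of_pos hx, one_mul]

lemma frobInner_map_sign_self (V : Matrix (Fin m) (Fin k) ℝ) :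
    frobInner (V.map Real.sign) V = oneNorm V := by
  simp only [frobInner, oneNorm, map_apply, sign_mul_self_eq_abs]

lemma mem_subdiffOneNorm_of_subgradGap_nonpos (hS : ∀ i j, |S i j| ≤ 1)
    (hgap : subgradGap S V ≤ 0) : S ∈ subdiffOneNorm V := by
  intro Y
  rw [subgradGap] at hgap
  rw [frobInner_sub_right]
  linarith [frobInner_le_oneNorm hS Y]

lemma abs_sub_mul_le_of_eq_sign {τ s x : ℝ} (hτ : 0 ≤ τ) (hs : s = Real.sign (τ * s + x)) :
    |x| - s * x ≤ 2 * τ := by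
  rcases lt_trichotomy (τ * s + x) 0 with hneg | hzero | hpos
  · obtain rfl := hs.trans (Real.sign_of_neg hneg)
    rcases abs_cases x with hx | hx <;> linarith
  · obtain rfl : s = 0 := by rw [hs, hzero, Real.sign_zero]
    obtain rfl : x = 0 := by rwa [mul_zero, zero_add] at hzero
    simpa using hτ
  · obtain rfl := hs.trans (Real.sign_of_pos hpos)
    rcases abs_cases x with hx | hx <;> linarith

lemma subgradGap_le_of_eq_map_sign {τ : ℝ} (hτ : 0 ≤ τ) (hS : S = (τ • S + V).map Real.sign) :
    subgradGap S V ≤ 2 * τ * (m * k) := by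
  simp only [subgradGap, oneNorm, frobInner, ← Finset.sum_sub_distrib]
  calc ∑ i, ∑ j, (|V i j| - S i j * V i j) ≤ ∑ _i : Fin m, ∑ _j : Fin k, 2 * τ :=
        Finset.sum_le_sum fun i _ => Finset.sum_le_sum fun j _ =>
          abs_sub_mul_le_of_eq_sign hτ (congr_fun₂ hS i j)
    _ = 2 * τ * (m * k) := by
        simp only [Finset.sum_const, Finset.card_univ, Fintype.card_fin, nsmul_eq_mul]
        ring

lemma continuous_subgradGap_transpose_mul {d : ℕ} (X : Matrix (Fin d) (Fin m) ℝ)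
    (S : Matrix (Fin m) (Fin k) ℝ) :
    Continuous fun U : Matrix (Fin d) (Fin k) ℝ => subgradGap S (Xᵀ * U) := by
  unfold subgradGap oneNorm frobInner
  fun_prop

end Sign

/-! ### Thresholds for the parameters -/

section Thresholds

variable {d n k : ℕ}

lemma isKKT_of_mem_polarFixedPoints {X : Matrix (Fin d) (Fin n) ℝ} {S : Matrix (Fin n) (Fin k) ℝ}
    {U : Matrix (Fin d) (Fin k) ℝ} {β : ℝ} (hU : U ∈ polarFixedPoints (X * S) β)
    (hS : S ∈ subdiffOneNorm (Xᵀ * U)) : IsKKT X U := by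
  obtain ⟨hUs, hfactor, hsymm, -⟩ := mem_polarFixedPoints_iff.1 hU
  exact ⟨hUs, _, hsymm, S, hS, hfactor⟩

lemma eventually_exists_mem_subdiffOneNorm (X : Matrix (Fin d) (Fin n) ℝ) :
    ∀ᶠ τ in 𝓝 (0 : ℝ), ∀ S ∈ signMatrices n k, ∀ β, 0 ≤ β → ∀ U ∈ polarFixedPoints (X * S) β,
      subgradGap S (Xᵀ * U) ≤ 2 * τ * (n * k) →
      ∃ V ∈ polarFixedPoints (X * S) β, S ∈ subdiffOneNorm (Xᵀ * V) := by
  have hgap : ∀ᶠ ε in 𝓝 (0 : ℝ), ∀ S ∈ signMatrices n k,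
      ∀ F ∈ polarFixedPoints (X * S) '' Set.Ici 0, ∀ U ∈ F, subgradGap S (Xᵀ * U) ≤ ε →
      ∃ V ∈ F, subgradGap S (Xᵀ * V) ≤ 0 := by
    refine (eventually_all_finite (finite_signMatrices n k)).2 fun S _ =>
      (eventually_all_finite (finite_image_polarFixedPoints (X * S))).2 ?_
    rintro _ ⟨β, -, rfl⟩
    exact eventually_exists_le_of_isCompact (isCompact_polarFixedPoints _ β)
      (continuous_subgradGap_transpose_mul X S).continuousOn.lowerSemicontinuousOn 0
  have herror : Tendsto (fun τ : ℝ => 2 * τ * (n * k)) (𝓝 0) (𝓝 0) :=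
    Continuous.tendsto' (by fun_prop) _ _ (by simp)
  filter_upwards [herror.eventually hgap] with τ hτ S hS β hβ U hU hUgap
  obtain ⟨V, hV, hVgap⟩ := hτ S hS _ ⟨β, hβ, rfl⟩ U hU hUgap
  exact ⟨V, hV, mem_subdiffOneNorm_of_subgradGap_nonpos
    (abs_apply_le_one_of_mem_signMatrices hS) hVgap⟩

lemma eventually_forall_polarFixedPoints_eq (X : Matrix (Fin d) (Fin n) ℝ) :
    ∀ᶠ β in 𝓝[>] (0 : ℝ), ∀ S ∈ signMatrices n k,
      polarFixedPoints (X * S) β = polarFixedPoints (X * S) 0 :=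
  (eventually_all_finite (finite_signMatrices n k)).2 fun S _ =>
    eventually_polarFixedPoints_eq (X * S)

lemma exists_pos_forall_mul_sq_mul_le (X : Matrix (Fin d) (Fin n) ℝ) {c : ℝ} (hc : 0 < c) :
    ∃ γ₀, 0 < γ₀ ∧ ∀ γ, 0 ≤ γ → γ < γ₀ → 4 * γ ^ 2 * frobInner X X ≤ c := by
  have hlim : Tendsto (fun γ : ℝ => 4 * γ ^ 2 * frobInner X X) (𝓝[≥] 0) (𝓝 0) :=
    (Continuous.tendsto' (by fun_prop) _ _ (by simp)).mono_left nhdsWithin_le_nhds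
  obtain ⟨γ₀, hγ₀, hle⟩ :=
    mem_nhdsGE_iff_exists_Ico_subset.1 (hlim.eventually (ge_mem_nhds hc))
  exact ⟨γ₀, hγ₀, fun γ hγ hγγ₀ => hle ⟨hγ, hγγ₀⟩⟩

end Thresholds

/-! ### The PAMe iteration -/

/-- The Lyapunov function of PAMe at the sign matrix `S`, the previous iterate `V` and the current
iterate `U`. The last term pays for the extrapolation from `V` through `U` in the next step. -/
noncomputable def lyapunov {d n K : ℕ} (X : Matrix (Fin d) (Fin n) ℝ) (τ β : ℝ)
    (S : Matrix (Fin n) (Fin K) ℝ) (V U : Matrix (Fin d) (Fin K) ℝ) : ℝ :=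
  frobInner S (Xᵀ * U) + τ / 2 * frobInner S S - β / 4 * frobInner (U - V) (U - V)

namespace IsPAMe

variable {d n K : ℕ} {X : Matrix (Fin d) (Fin n) ℝ} {τ β γ : ℝ}
  {U : ℕ → Matrix (Fin d) (Fin K) ℝ} {S : ℕ → Matrix (Fin n) (Fin K) ℝ}
  {E : ℕ → Matrix (Fin d) (Fin K) ℝ}

lemma mem_signMatrices (h : IsPAMe X τ β γ U S E) (k : ℕ) : S k ∈ signMatrices n K := by
  cases k with
  | zero => exact h.init_S
  | succ k =>
    rw [h.step_S k]
    exact map_sign_mem_signMatrices _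

lemma mem_stiefel (h : IsPAMe X τ β γ U S E) (k : ℕ) : U k ∈ stiefel d K := by
  cases k with
  | zero => exact h.init_U
  | succ k => exact (h.step_U k).1

lemma sign_step_gain (h : IsPAMe X τ β γ U S E) (k : ℕ) :
    τ / 2 * frobInner (S (k + 1) - S k) (S (k + 1) - S k) ≤
      frobInner (S (k + 1)) (Xᵀ * E k) - frobInner (S k) (Xᵀ * E k) +
        τ / 2 * (frobInner (S (k + 1)) (S (k + 1)) - frobInner (S k) (S k)) := by
  refine proximal_gain ?_
  conv_rhs => rw [h.step_S k, frobInner_map_sign_self]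
  exact frobInner_le_oneNorm (abs_apply_le_one_of_mem_signMatrices (h.mem_signMatrices k)) _

lemma polar_step_gain (h : IsPAMe X τ β γ U S E) (k : ℕ) :
    β / 2 * frobInner (U (k + 1) - U k) (U (k + 1) - U k) ≤
      frobInner (S (k + 1)) (Xᵀ * U (k + 1)) - frobInner (S (k + 1)) (Xᵀ * U k) := by
  have hgain := proximal_gain ((h.step_U k).frobInner_le (h.mem_stiefel k))
  rw [frobInner_self_of_mem_stiefel (h.mem_stiefel k),
    frobInner_self_of_mem_stiefel (h.mem_stiefel (k + 1)), sub_self, mul_zero, add_zero] at hgain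
  rwa [frobInner_transpose_mul_right, frobInner_transpose_mul_right, frobInner_comm (X * _),
    frobInner_comm (X * _)]

lemma extrapolation_eq (h : IsPAMe X τ β γ U S E) (k : ℕ) :
    E (k + 1) = U (k + 1) + γ • (U (k + 1) - U k) := by
  rw [h.step_E, ← neg_sub (U (k + 1)) (U k), smul_neg, sub_neg_eq_add]

lemma lyapunov_gain (h : IsPAMe X τ β γ U S E) (hτ : 0 ≤ τ) (hβ : 0 ≤ β)
    (hγ : 4 * γ ^ 2 * frobInner X X ≤ τ * β) (k : ℕ) :
    τ / 4 * frobInner (S (k + 2) - S (k + 1)) (S (k + 2) - S (k + 1)) +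
        β / 4 * frobInner (U (k + 2) - U (k + 1)) (U (k + 2) - U (k + 1)) ≤
      lyapunov X τ β (S (k + 2)) (U (k + 1)) (U (k + 2)) -
        lyapunov X τ β (S (k + 1)) (U k) (U (k + 1)) := by
  have hS := h.sign_step_gain (k + 1)
  have hU := h.polar_step_gain (k + 1)
  have hE := mul_frobInner_transpose_mul_le hτ hβ hγ (S (k + 2) - S (k + 1)) (U (k + 1) - U k)
  simp only [h.extrapolation_eq, Matrix.mul_add, Matrix.mul_smul, frobInner_add_right,
    frobInner_smul_right] at hS
  rw [frobInner_sub_left (S (k + 2))] at hE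
  simp only [lyapunov]
  linarith

lemma bddAbove_range_lyapunov (h : IsPAMe X τ β γ U S E) :
    BddAbove (Set.range fun k => lyapunov X τ β (S (k + 1)) (U k) (U (k + 1))) := by
  have hcompact := (finite_signMatrices n K).isCompact.prod
    ((isCompact_stiefel d K).prod (isCompact_stiefel d K))
  have hcont : Continuous fun p : Matrix (Fin n) (Fin K) ℝ × Matrix (Fin d) (Fin K) ℝ ×
      Matrix (Fin d) (Fin K) ℝ => lyapunov X τ β p.1 p.2.1 p.2.2 := by
    unfold lyapunov frobInner
    fun_prop
  refine (hcompact.bddAbove_image hcont.continuousOn).mono ?_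
  rintro _ ⟨k, rfl⟩
  exact ⟨(S (k + 1), U k, U (k + 1)),
    ⟨h.mem_signMatrices (k + 1), h.mem_stiefel k, h.mem_stiefel (k + 1)⟩, rfl⟩

lemma tendsto_gain (h : IsPAMe X τ β γ U S E) (hτ : 0 ≤ τ) (hβ : 0 ≤ β)
    (hγ : 4 * γ ^ 2 * frobInner X X ≤ τ * β) :
    Tendsto (fun k => τ / 4 * frobInner (S (k + 1) - S k) (S (k + 1) - S k) +
      β / 4 * frobInner (U (k + 1) - U k) (U (k + 1) - U k)) atTop (𝓝 0) := by
  refine (tendsto_add_atTop_iff_nat 1).1 (tendsto_zero_of_le_sub_of_bddAbove (fun k => ?_)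
    (h.lyapunov_gain hτ hβ hγ) h.bddAbove_range_lyapunov)
  have hS := frobInner_self_nonneg (S (k + 1 + 1) - S (k + 1))
  have hU := frobInner_self_nonneg (U (k + 1 + 1) - U (k + 1))
  positivity

lemma tendsto_frobInner_sub_S (h : IsPAMe X τ β γ U S E) (hτ : 0 < τ) (hβ : 0 ≤ β)
    (hγ : 4 * γ ^ 2 * frobInner X X ≤ τ * β) :
    Tendsto (fun k => frobInner (S (k + 1) - S k) (S (k + 1) - S k)) atTop (𝓝 0) := by
  have hlim := (h.tendsto_gain hτ.le hβ hγ).const_mul (4 / τ)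
  rw [mul_zero] at hlim
  refine squeeze_zero (fun k => frobInner_self_nonneg _) (fun k => ?_) hlim
  have hU := frobInner_self_nonneg (U (k + 1) - U k)
  rw [mul_add, ← mul_assoc, div_mul_div_cancel₀ hτ.ne', div_self four_ne_zero, one_mul]
  exact le_add_of_nonneg_right (by positivity)

lemma tendsto_sub_U (h : IsPAMe X τ β γ U S E) (hτ : 0 ≤ τ) (hβ : 0 < β)
    (hγ : 4 * γ ^ 2 * frobInner X X ≤ τ * β) :
    Tendsto (fun k => U (k + 1) - U k) atTop (𝓝 0) := by
  have hlim := (h.tendsto_gain hτ hβ.le hγ).const_mul (4 / β)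
  rw [mul_zero] at hlim
  refine tendsto_zero_of_tendsto_frobInner_self
    (squeeze_zero (fun k => frobInner_self_nonneg _) (fun k => ?_) hlim)
  have hS := frobInner_self_nonneg (S (k + 1) - S k)
  rw [mul_add, ← mul_assoc (4 / β) (β / 4), div_mul_div_cancel₀ hβ.ne', div_self four_ne_zero,
    one_mul]
  exact le_add_of_nonneg_left (by positivity)

lemma tendsto_E_sub_U (h : IsPAMe X τ β γ U S E) (hτ : 0 ≤ τ) (hβ : 0 < β)
    (hγ : 4 * γ ^ 2 * frobInner X X ≤ τ * β) :
    Tendsto (fun k => E k - U k) atTop (𝓝 0) := by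
  rw [← tendsto_add_atTop_iff_nat 1, ← smul_zero γ]
  refine ((h.tendsto_sub_U hτ hβ hγ).const_smul γ).congr fun k => ?_
  rw [h.extrapolation_eq, add_sub_cancel_left]

lemma exists_isLeast_constant (h : IsPAMe X τ β γ U S E) (hτ : 0 < τ) (hβ : 0 ≤ β)
    (hγ : 4 * γ ^ 2 * frobInner X X ≤ τ * β) :
    ∃ k', IsLeast {k : ℕ | ∀ m, k ≤ m → S m = S k} k' := by
  obtain ⟨N, hN⟩ := eventually_atTop.1
    ((h.tendsto_frobInner_sub_S hτ hβ hγ).eventually (gt_mem_nhds one_pos))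
  have hconst : ∀ m, N ≤ m → S m = S N := fun m hm => by
    induction m, hm using Nat.le_induction with
    | base => rfl
    | succ m hm ih =>
      exact (eq_of_mem_signMatrices_of_frobInner_lt_one (h.mem_signMatrices _)
        (h.mem_signMatrices _) (hN m hm)).trans ih
  exact ⟨_, Nat.sInf_mem ⟨N, hconst⟩, fun _ => Nat.sInf_le⟩

lemma exists_mem_polarFixedPoints (h : IsPAMe X τ β γ U S E) (hτ : 0 ≤ τ) (hβ : 0 < β)
    (hγ : 4 * γ ^ 2 * frobInner X X ≤ τ * β) {k₀ : ℕ} (hS : ∀ k, k₀ ≤ k → S k = S k₀) :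
    ∃ V ∈ polarFixedPoints (X * S k₀) β, subgradGap (S k₀) (Xᵀ * V) ≤ 2 * τ * (n * K) := by
  obtain ⟨V, -, hcluster⟩ :=
    (isCompact_stiefel d K).exists_mapClusterPt (f := atTop) (u := U)
      (tendsto_principal.2 (Eventually.of_forall h.mem_stiefel))
  obtain ⟨l, hl, hUV⟩ := mapClusterPt_iff_ultrafilter.1 hcluster
  have hsuccV : Tendsto (fun k => U (k + 1)) l (𝓝 V) := by
    simpa using ((h.tendsto_sub_U hτ hβ hγ).mono_left hl).add hUV
  have hEV : Tendsto E l (𝓝 V) := by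
    simpa using ((h.tendsto_E_sub_U hτ hβ hγ).mono_left hl).add hUV
  have hlarge : ∀ᶠ k in (l : Filter ℕ), k₀ ≤ k := hl (eventually_ge_atTop k₀)
  refine ⟨V, ?_, ?_⟩
  · refine (isClosed_setOf_isUFactor d K).mem_of_tendsto
      (((hUV.const_smul β).add_const (X * S k₀)).prodMk_nhds hsuccV) ?_
    filter_upwards [hlarge] with k hk
    simpa only [hS (k + 1) (by lia)] using h.step_U k
  · refine le_of_tendsto (((continuous_subgradGap_transpose_mul X (S k₀)).tendsto V).comp hEV) ?_
    filter_upwards [hlarge] with k hk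
    refine subgradGap_le_of_eq_map_sign hτ ?_
    simpa only [hS (k + 1) (by lia), hS k hk] using h.step_S k

end IsPAMe

end L1PCA

theorem mainTheorem4_general {d n K : ℕ} (X : Matrix (Fin d) (Fin n) ℝ) :
    ∃ τ₀ : ℝ, 0 < τ₀ ∧ ∃ β₀ : ℝ, 0 < β₀ ∧
    ∀ τ β γ : ℝ, 0 < τ → 0 < β → 4 * γ ^ 2 * L1PCA.frobInner X X ≤ τ * β →
    ∀ (U : ℕ → Matrix (Fin d) (Fin K) ℝ) (S : ℕ → Matrix (Fin n) (Fin K) ℝ)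
      (E : ℕ → Matrix (Fin d) (Fin K) ℝ), L1PCA.IsPAMe X τ β γ U S E →
    ∃ (k' : ℕ) (Sstar : Matrix (Fin n) (Fin K) ℝ),
      (IsLeast {k : ℕ | ∀ m, k ≤ m → S m = S k} k' ∧ ∀ k, k' ≤ k → S k = Sstar) ∧
      (τ < τ₀ → ∃ Ustar : Matrix (Fin d) (Fin K) ℝ,
        (L1PCA.IsUFactor (β • Ustar + X * Sstar) Ustar ∧
          Sstar ∈ L1PCA.subdiffOneNorm (X.transpose * Ustar) ∧
          L1PCA.IsKKT X Ustar) ∧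
        (β < β₀ → L1PCA.IsUFactor (X * Sstar) Ustar ∧ L1PCA.IsFOC X Ustar)) ∧
      (τ < τ₀ → β < β₀ → (X * Sstar).rank = K →
        ∃ V : Matrix (Fin d) (Fin K) ℝ,
          L1PCA.IsUFactor (X * S k') V ∧
          (∀ V', L1PCA.IsUFactor (X * S k') V' → V' = V) ∧
          L1PCA.IsFOC X V) := by
  obtain ⟨τ₀, hτ₀, hgap⟩ := mem_nhdsGT_iff_exists_Ioo_subset.1
    (mem_nhdsWithin_of_mem_nhds (L1PCA.eventually_exists_mem_subdiffOneNorm (k := K) X))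
  obtain ⟨β₀, hβ₀, hfix⟩ := mem_nhdsGT_iff_exists_Ioo_subset.1
    (L1PCA.eventually_forall_polarFixedPoints_eq (k := K) X)
  refine ⟨τ₀, hτ₀, β₀, hβ₀, fun τ β γ hτ hβ hγ U S E h => ?_⟩
  obtain ⟨k', hk'⟩ := h.exists_isLeast_constant hτ hβ.le hγ
  have hsign := h.mem_signMatrices k'
  have hsub (hττ₀ : τ < τ₀) : ∃ V ∈ L1PCA.polarFixedPoints (X * S k') β,
      S k' ∈ L1PCA.subdiffOneNorm (X.transpose * V) := by
    obtain ⟨W, hW, hWgap⟩ := h.exists_mem_polarFixedPoints hτ.le hβ hγ hk'.1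
    exact hgap ⟨hτ, hττ₀⟩ (S k') hsign β hβ.le W hW hWgap
  have hpolar (hββ₀ : β < β₀) {V : Matrix (Fin d) (Fin K) ℝ}
      (hV : V ∈ L1PCA.polarFixedPoints (X * S k') β) : L1PCA.IsUFactor (X * S k') V := by
    rwa [hfix ⟨hβ, hββ₀⟩ (S k') hsign, L1PCA.mem_polarFixedPoints_zero] at hV
  refine ⟨k', S k', ⟨hk', hk'.1⟩, fun hττ₀ => ?_, fun hττ₀ hββ₀ hrank => ?_⟩
  · obtain ⟨V, hV, hVsub⟩ := hsub hττ₀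
    exact ⟨V, ⟨hV, hVsub, L1PCA.isKKT_of_mem_polarFixedPoints hV hVsub⟩,
      fun hββ₀ => ⟨hpolar hββ₀ hV, S k', hVsub, hpolar hββ₀ hV⟩⟩
  · obtain ⟨V, hV, hVsub⟩ := hsub hττ₀
    have hVpolar := hpolar hββ₀ hV
    exact ⟨V, hVpolar, fun V' hV' => hV'.eq_of_rank_eq hVpolar hrank, S k', hVsub, hVpolar⟩

theorem mainTheorem4 {d n K : ℕ} (X : Matrix (Fin d) (Fin n) ℝ) :
    ∃ τ₀ : ℝ, 0 < τ₀ ∧ ∃ β₀ : ℝ, 0 < β₀ ∧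
    ∀ τ β : ℝ, 0 < τ → 0 < β →
    ∃ γ₀ : ℝ, 0 < γ₀ ∧
    ∀ γ : ℝ, 0 ≤ γ → γ < 1 → γ < γ₀ →
    ∀ (U : ℕ → Matrix (Fin d) (Fin K) ℝ) (S : ℕ → Matrix (Fin n) (Fin K) ℝ)
      (E : ℕ → Matrix (Fin d) (Fin K) ℝ), L1PCA.IsPAMe X τ β γ U S E →
    ∃ (k' : ℕ) (Sstar : Matrix (Fin n) (Fin K) ℝ),
      -- the sign variable is constant from the first index `k'` on
      (IsLeast {k : ℕ | ∀ m, k ≤ m → S m = S k} k' ∧ ∀ k, k' ≤ k → S k = Sstar) ∧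
      -- small `τ`: a KKT point; small `τ` and `β`: a `U`-factor of `X S*` that is a FOC point
      (τ < τ₀ → ∃ Ustar : Matrix (Fin d) (Fin K) ℝ,
        (L1PCA.IsUFactor (β • Ustar + X * Sstar) Ustar ∧
          Sstar ∈ L1PCA.subdiffOneNorm (X.transpose * Ustar) ∧
          L1PCA.IsKKT X Ustar) ∧
        (β < β₀ → L1PCA.IsUFactor (X * Sstar) Ustar ∧ L1PCA.IsFOC X Ustar)) ∧
      -- full rank: the `U`-factor of `X S^{k'}` is unique, and it is a FOC point
      (τ < τ₀ → β < β₀ → (X * Sstar).rank = K →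
        ∃ V : Matrix (Fin d) (Fin K) ℝ,
          L1PCA.IsUFactor (X * S k') V ∧
          (∀ V', L1PCA.IsUFactor (X * S k') V' → V' = V) ∧
          L1PCA.IsFOC X V) := by
  obtain ⟨τ₀, hτ₀, β₀, hβ₀, hconv⟩ := mainTheorem4_general (K := K) X
  refine ⟨τ₀, hτ₀, β₀, hβ₀, fun τ β hτ hβ => ?_⟩
  obtain ⟨γ₀, hγ₀, hγ⟩ := L1PCA.exists_pos_forall_mul_sq_mul_le X (mul_pos hτ hβ)
  exact ⟨γ₀, hγ₀, fun γ hγ0 _ hγγ₀ => hconv τ β γ hτ hβ (hγ γ hγ0 hγγ₀)⟩
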